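/- Let $n \ge 0$. A set $K \subseteq \mathbb{R}^n$ is called an embedded simplicial complex if it is the union of the simplices of a finite (geometric) simplicial complex in $\mathbb{R}^n$. For $M \in \mathrm{GL}_n(\mathbb{R})$ and $w \in \mathbb{R}^n$ write $MK := \{M^{-1}x \mid x \in K\}$ (note the inverse) and $K + w := \{x + w \mid x \in K\}$. For a unit vector $v \in S^{n-1}$ and $r \in \mathbb{R}$ put $$K_{v,r} := \{x \in \mathbb{R}^n \mid x\cdot v \le r\} \cap K, \qquad \mathcal{F}_K(v,r) := \chi(K_{v,r}).$$ Here the Euler characteristic of a set $S \subseteq \mathbb{R}^n$ that has a finite partition into semialgebraic cells (in the usual sense of o-minimal geometry) is $\chi(S) = \sum_{d=0}^n (-1)^d k_d$, where $k_d$ is the number of $d$-dimensional cells in such a partition; it does not depend on the partition. **Proposition.** Let $K$ be an embedded simplicial complex in $\mathbb{R}^n$, let $R \in \mathrm{O}(n)$ and let $w \in \mathbb{R}^n$. Then $RK + w$ is again an embedded simplicial complex; for all $v \in S^{n-1}$ and $r \in \mathbb{R}$ the sets $K_{v,r}$ and $(RK+w)_{v,r}$ have finite partitions into semialgebraic cells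 (so that $\mathcal{F}_K$ and $\mathcal{F}_{RK+w}$ are well defined); and $$\mathcal{F}_{RK+w}(v,r) = \mathcal{F}_K(Rv,\ r - v\cdot w) \qquad \text{for all } v \in S^{n-1},\ r \in \mathbb{R}.$$ -/

import Mathlib

open scoped Matrix

namespace EulerCurve

/-! ### Semialgebraic sets and cells -/

/-- Semialgebraic subsets of `ℝⁿ`: the sets obtained by finite unions and intersections from sets
of the form `{f > 0}` and `{g = 0}`, with `f` and `g` real polynomials in `n` variables. -/
inductive IsSemialgebraic {n : ℕ} : Set (Fin n → ℝ) → Prop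
  | pos (f : MvPolynomial (Fin n) ℝ) : IsSemialgebraic {x | 0 < MvPolynomial.eval x f}
  | zero (g : MvPolynomial (Fin n) ℝ) : IsSemialgebraic {x | MvPolynomial.eval x g = 0}
  | union {A B : Set (Fin n → ℝ)} :
      IsSemialgebraic A → IsSemialgebraic B → IsSemialgebraic (A ∪ B)
  | inter {A B : Set (Fin n → ℝ)} :
      IsSemialgebraic A → IsSemialgebraic B → IsSemialgebraic (A ∩ B)

/-- The graph, in `ℝⁿ⁺¹`, of the restriction of `f` to `B ⊆ ℝⁿ`. -/
def graphOver {n : ℕ} (B : Set (Fin n → ℝ)) (f : (Fin n → ℝ) → ℝ) : Set (Fin (n + 1) → ℝ) :=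
  {x | Fin.init x ∈ B ∧ x (Fin.last n) = f (Fin.init x)}

/-- `f` restricts to a continuous semialgebraic function `B → ℝ`. -/
def IsCellFunction {n : ℕ} (B : Set (Fin n → ℝ)) (f : (Fin n → ℝ) → ℝ) : Prop :=
  ContinuousOn f B ∧ IsSemialgebraic (graphOver B f)

/-- `f` restricts on `B` to a continuous semialgebraic real function, or to one of the constants
`-∞` and `+∞`. -/
def IsCellBound {n : ℕ} (B : Set (Fin n → ℝ)) (f : (Fin n → ℝ) → EReal) : Prop :=
  (∀ x ∈ B, f x = ⊥) ∨ (∀ x ∈ B, f x = ⊤) ∨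
    ∃ g : (Fin n → ℝ) → ℝ, IsCellFunction B g ∧ ∀ x ∈ B, f x = (g x : EReal)

/-- The part of the cylinder over `B` that lies strictly between `f` and `g`. -/
def bandOver {n : ℕ} (B : Set (Fin n → ℝ)) (f g : (Fin n → ℝ) → EReal) :
    Set (Fin (n + 1) → ℝ) :=
  {x | Fin.init x ∈ B ∧ f (Fin.init x) < (x (Fin.last n) : EReal) ∧
    (x (Fin.last n) : EReal) < g (Fin.init x)}

/-- `IsCell d C`: the set `C ⊆ ℝⁿ` is a semialgebraic cell of dimension `d`, in the usual sense of
o-minimal geometry. The point `ℝ⁰` is a cell of dimension `0`; over a cell `B ⊆ ℝⁿ` of dimension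
`d`, graphs of continuous semialgebraic functions are cells of dimension `d` in `ℝⁿ⁺¹`, and open
bands between two such functions (or `±∞`) are cells of dimension `d + 1`. -/
inductive IsCell : {n : ℕ} → ℕ → Set (Fin n → ℝ) → Prop
  | point : IsCell (n := 0) 0 Set.univ
  | graph {n d : ℕ} {B : Set (Fin n → ℝ)} {f : (Fin n → ℝ) → ℝ} (hB : IsCell d B)
      (hf : IsCellFunction B f) : IsCell (n := n + 1) d (graphOver B f)
  | band {n d : ℕ} {B : Set (Fin n → ℝ)} {f g : (Fin n → ℝ) → EReal} (hB : IsCell d B)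
      (hf : IsCellBound B f) (hg : IsCellBound B g) (hfg : ∀ x ∈ B, f x < g x) :
      IsCell (n := n + 1) (d + 1) (bandOver B f g)

/-! ### The Euler characteristic -/

/-- A finite partition of `S ⊆ ℝⁿ` into semialgebraic cells, with their dimensions. -/
structure CellPartition {n : ℕ} (S : Set (Fin n → ℝ)) where
  cells : Finset (Set (Fin n → ℝ))
  dim : Set (Fin n → ℝ) → ℕ
  isCell : ∀ C ∈ cells, IsCell (dim C) C
  disjoint : (cells : Set (Set (Fin n → ℝ))).PairwiseDisjoint id
  sUnion_eq : ⋃₀ (cells : Set (Set (Fin n → ℝ))) = S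

namespace CellPartition

/-- The number `k_d` of cells of dimension `d`. -/
def count {n : ℕ} {S : Set (Fin n → ℝ)} (P : CellPartition S) (d : ℕ) : ℕ :=
  (P.cells.filter fun C => P.dim C = d).card

/-- The Euler characteristic with respect to a partition: `k_0 - k_1 + ⋯ + (-1)ⁿ k_n`. -/
def eulerChar {n : ℕ} {S : Set (Fin n → ℝ)} (P : CellPartition S) : ℤ :=
  ∑ d ∈ Finset.range (n + 1), (-1) ^ d * (P.count d : ℤ)

end CellPartition

open Classical in
/-- The Euler characteristic `χ(S)` of a set that has a finite partition into semialgebraic cells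
(and `0` for other sets). It does not depend on the partition: see `eulerChar_eq`. -/
noncomputable def eulerChar {n : ℕ} (S : Set (Fin n → ℝ)) : ℤ :=
  if h : Nonempty (CellPartition S) then h.some.eulerChar else 0

/-! ### Independence of the partition -/

theorem IsCell.dim_le {n d : ℕ} {C : Set (Fin n → ℝ)} (h : IsCell d C) : d ≤ n := by
  induction h with
  | point => exact le_rfl
  | graph _ _ ih => omega
  | band _ _ _ _ ih => omega

theorem CellPartition.eulerChar_eq_sum {n : ℕ} {S : Set (Fin n → ℝ)} (P : CellPartition S) :
    P.eulerChar = ∑ C ∈ P.cells, (-1) ^ P.dim C := by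
  have hm : ∀ C ∈ P.cells, P.dim C ∈ Finset.range (n + 1) := fun C hC =>
    Finset.mem_range.2 (Nat.lt_succ_of_le (P.isCell C hC).dim_le)
  rw [← Finset.sum_fiberwise_of_maps_to hm]
  refine Finset.sum_congr rfl fun d _ => ?_
  rw [Finset.sum_congr rfl (g := fun _ => (-1 : ℤ) ^ d)
    (fun C hC => by rw [(Finset.mem_filter.1 hC).2])]
  simp [CellPartition.count, mul_comm]

/-- `FibreType J e`: `J` is a point and `e = 1`, or `J` is an open interval and `e = -1`. -/
def FibreType (J : Set ℝ) (e : ℤ) : Prop :=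
  (∃ p : ℝ, J = {p} ∧ e = 1) ∨
    ∃ a b : EReal, a < b ∧ J = {t : ℝ | a < (t : EReal) ∧ (t : EReal) < b} ∧ e = -1

theorem exists_right_point (A : Finset ℝ) (a : ℝ) : ∃ s, a < s ∧ ∀ b ∈ A, a < b → s < b := by
  classical
  induction A using Finset.induction_on with
  | empty => exact ⟨a + 1, by linarith, by simp⟩
  | insert c A _ ih =>
    obtain ⟨s, hs, h⟩ := ih
    by_cases hc : a < c
    · refine ⟨min s ((a + c) / 2), lt_min hs (by linarith), fun b hb hab => ?_⟩
      rcases Finset.mem_insert.1 hb with rfl | hb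
      · exact (min_le_right _ _).trans_lt (by linarith)
      · exact (min_le_left _ _).trans_lt (h b hb hab)
    · refine ⟨s, hs, fun b hb hab => ?_⟩
      rcases Finset.mem_insert.1 hb with rfl | hb
      · exact absurd hab hc
      · exact h b hb hab

open Classical in
/-- The indicator function of a set. -/
noncomputable def ind {α : Type*} (S : Set α) (x : α) : ℤ :=
  if x ∈ S then 1 else 0

theorem fibre_test {A : Finset ℝ} {s : ℝ → ℝ} {m : ℝ} (hs : ∀ a, a < s a)
    (hs' : ∀ a, ∀ b ∈ A, a < b → s a < b) (hm : ∀ b ∈ A, m < b) {J : Set ℝ} {e : ℤ}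
    (hJ : (∃ p : ℝ, J = {p} ∧ e = 1 ∧ p ∈ A) ∨ ∃ a b : EReal, a < b ∧
      J = {t : ℝ | a < (t : EReal) ∧ (t : EReal) < b} ∧ e = -1 ∧
      (∀ p : ℝ, a = p → p ∈ A) ∧ ∀ p : ℝ, b = p → p ∈ A) :
    (∑ a ∈ A, (ind J a - ind J (s a)))
      - ind J m = e := by
  classical
  rcases hJ with ⟨p, rfl, rfl, hp⟩ | ⟨a, b, hab, rfl, rfl, ha, hb⟩
  · have h1 : ∀ a ∈ A, ind {p} a - ind {p} (s a) = if a = p then 1 else 0 := by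
      intro a _
      have : s a ≠ p := by
        intro h
        have h1 := hs a
        have h2 := hs' a p hp (h ▸ h1)
        exact absurd h h2.ne
      simp [ind, this]
    rw [Finset.sum_congr rfl h1]
    simp [ind, hp, (hm p hp).ne]
  · have hbb : ∀ x y : ℝ, (∀ c ∈ A, x < c → y < c) → (x : EReal) < b → (y : EReal) < b := by
      intro x y hxy hxb
      induction b with
      | bot => simp at hxb
      | top => exact EReal.coe_lt_top _
      | coe q => exact_mod_cast hxy q (hb q rfl) (by exact_mod_cast hxb)
    induction a with
    | top => simp at hab
    | bot =>
      have h1 : ∀ x ∈ A, ind {t : ℝ | (⊥ : EReal) < t ∧ (t : EReal) < b} x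
          - ind {t : ℝ | (⊥ : EReal) < t ∧ (t : EReal) < b} (s x) = 0 := by
        intro x _
        have : ((s x : ℝ) : EReal) < b ↔ (x : EReal) < b :=
          ⟨fun h => lt_trans (by exact_mod_cast hs x) h, hbb x (s x) (hs' x)⟩
        simp [ind, this]
      have h2 : (m : EReal) < b := by
        induction b with
        | bot => simp at hab
        | top => exact EReal.coe_lt_top _
        | coe q => exact_mod_cast hm q (hb q rfl)
      rw [Finset.sum_eq_zero h1]
      simp [ind, h2]
    | coe p =>
      have hp := ha p rfl
      have h1 : ∀ x ∈ A, ind {t : ℝ | (p : EReal) < t ∧ (t : EReal) < b} x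
          - ind {t : ℝ | (p : EReal) < t ∧ (t : EReal) < b} (s x)
          = if x = p then -1 else 0 := by
        intro x _
        have h3 : ((s x : ℝ) : EReal) < b ↔ (x : EReal) < b :=
          ⟨fun h => lt_trans (by exact_mod_cast hs x) h, hbb x (s x) (hs' x)⟩
        rcases lt_trichotomy x p with h | rfl | h
        · have := hs' x p hp h
          simp [ind, h.ne, not_lt.2 h.le, not_lt.2 this.le]
        · simp [ind, hs x, h3, hab]
        · simp [ind, h.ne', h, h.trans (hs x), h3]
      rw [Finset.sum_congr rfl h1]
      simp [ind, hp, not_lt.2 (hm p hp).le]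

theorem fibre_relation {ι : Type*} (I : Finset ι) (c e : ι → ℤ) (J : ι → Set ℝ)
    (hJ : ∀ i ∈ I, FibreType (J i) (e i))
    (h : ∀ t, ∑ i ∈ I, c i * ind (J i) t = 0) : ∑ i ∈ I, c i * e i = 0 := by
  have key : ∀ i ∈ I, ∃ A : Finset ℝ, ∀ A', A ⊆ A' → (∃ p : ℝ, J i = {p} ∧ e i = 1 ∧ p ∈ A') ∨
      ∃ a b : EReal, a < b ∧ J i = {t : ℝ | a < (t : EReal) ∧ (t : EReal) < b} ∧ e i = -1 ∧
      (∀ p : ℝ, a = p → p ∈ A') ∧ ∀ p : ℝ, b = p → p ∈ A' := by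
    intro i hi
    rcases hJ i hi with ⟨p, h1, h2⟩ | ⟨a, b, hab, h1, h2⟩
    · exact ⟨{p}, fun A' hA => Or.inl ⟨p, h1, h2, hA (by simp)⟩⟩
    · refine ⟨{a.toReal, b.toReal}, fun A' hA => Or.inr ⟨a, b, hab, h1, h2, ?_, ?_⟩⟩
      · rintro p rfl
        exact hA (by simp)
      · rintro p rfl
        exact hA (by simp)
  classical
  choose! A hA using key
  choose s hs hs' using exists_right_point (I.biUnion A)
  obtain ⟨m, hm⟩ : ∃ m, ∀ b ∈ I.biUnion A, m < b := by
    obtain ⟨m, hm⟩ := (I.biUnion A).bddBelow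
    exact ⟨m - 1, fun b hb => by linarith [hm hb]⟩
  have h1 : ∀ i ∈ I, e i = _ := fun i hi =>
    (fibre_test hs hs' hm (hA i hi _ (Finset.subset_biUnion_of_mem A hi))).symm
  rw [Finset.sum_congr rfl fun i hi => by rw [h1 i hi]]
  simp only [mul_sub, Finset.mul_sum, Finset.sum_sub_distrib]
  rw [Finset.sum_comm, Finset.sum_comm (t := I.biUnion A)]
  simp [h]

theorem IsCell.fibres {n d : ℕ} {C : Set (Fin (n + 1) → ℝ)} (h : IsCell d C) :
    ∃ (B : Set (Fin n → ℝ)) (k : ℕ) (e : ℤ) (J : (Fin n → ℝ) → Set ℝ), IsCell k B ∧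
      (-1) ^ d = e * (-1) ^ k ∧ (∀ y ∈ B, FibreType (J y) e) ∧
      ∀ y t, Fin.snoc (α := fun _ => ℝ) y t ∈ C ↔ y ∈ B ∧ t ∈ J y := by
  cases h with
  | @graph _ _ B f hB hf =>
    exact ⟨B, d, 1, fun y => {f y}, hB, by simp, fun y _ => Or.inl ⟨f y, rfl, rfl⟩,
      fun y t => by simp [graphOver]⟩
  | @band _ k B f g hB hf hg hfg =>
    exact ⟨B, k, -1, fun y => {t | f y < (t : EReal) ∧ (t : EReal) < g y}, hB, by ring,
      fun y hy => Or.inr ⟨f y, g y, hfg y hy, rfl, rfl⟩, fun y t => by simp [bandOver]⟩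

theorem cell_relation {ι : Type*} (I : Finset ι) : ∀ (n : ℕ) (c : ι → ℤ) (d : ι → ℕ)
    (C : ι → Set (Fin n → ℝ)), (∀ i ∈ I, IsCell (d i) (C i)) →
    (∀ x, ∑ i ∈ I, c i * ind (C i) x = 0) → ∑ i ∈ I, c i * (-1) ^ d i = 0 := by
  classical
  intro n
  induction n with
  | zero =>
    intro c d C hC h
    refine Eq.trans ?_ (h 0)
    refine Finset.sum_congr rfl fun i hi => ?_
    obtain ⟨h1, h2⟩ : d i = 0 ∧ C i = Set.univ := by
      have hc := hC i hi
      generalize d i = a at hc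
      generalize C i = D at hc
      cases hc
      exact ⟨rfl, rfl⟩
    simp [ind, h1, h2]
  | succ n ih =>
    intro c d C hC h
    have hf := fun i hi => (hC i hi).fibres
    choose! B k e J hB hd hJ hm using hf
    have h2 := ih (fun i => c i * e i) k B hB (fun y => ?_)
    · rw [← h2]
      exact Finset.sum_congr rfl fun i hi => by rw [hd i hi]; ring
    · have h3 := fibre_relation (I.filter fun i => y ∈ B i) c e (fun i => J i y)
        (fun i hi => hJ i (Finset.mem_filter.1 hi).1 y (Finset.mem_filter.1 hi).2) (fun t => by
          refine Eq.trans ?_ (h (Fin.snoc (α := fun _ => ℝ) y t))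
          rw [Finset.sum_filter]
          refine Finset.sum_congr rfl fun i hi => ?_
          have := hm i hi y t
          by_cases hy : y ∈ B i <;> simp [ind, this, hy])
      refine Eq.trans ?_ h3
      rw [Finset.sum_filter]
      exact Finset.sum_congr rfl fun i _ => by by_cases hy : y ∈ B i <;> simp [ind, hy]

theorem CellPartition.sum_indicator {n : ℕ} {S : Set (Fin n → ℝ)} (P : CellPartition S)
    (x : Fin n → ℝ) :
    ∑ C ∈ P.cells, ind C x = ind S x := by
  classical
  by_cases hx : x ∈ S
  · obtain ⟨C, hC, hxC⟩ := P.sUnion_eq.symm ▸ hx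
    rw [Finset.sum_eq_single C, ind, ind, if_pos hxC, if_pos hx]
    · intro D hD hne
      refine if_neg fun hxD => ?_
      exact Set.disjoint_left.1 (P.disjoint hD hC hne) hxD hxC
    · exact fun h => absurd hC h
  · rw [ind, if_neg hx]
    refine Finset.sum_eq_zero fun C hC => if_neg fun hxC => hx ?_
    rw [← P.sUnion_eq]
    exact ⟨C, hC, hxC⟩

/-- Two finite cell partitions of the same set give the same Euler characteristic. -/
theorem CellPartition.eulerChar_congr {n : ℕ} {S : Set (Fin n → ℝ)} (P Q : CellPartition S) :
    P.eulerChar = Q.eulerChar := by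
  classical
  have h := cell_relation (P.cells.disjSum Q.cells) n (Sum.elim (fun _ => 1) (fun _ => -1))
    (Sum.elim P.dim Q.dim) (Sum.elim id id)
    (by
      intro i hi
      rcases Finset.mem_disjSum.1 hi with ⟨C, hC, rfl⟩ | ⟨C, hC, rfl⟩
      · exact P.isCell C hC
      · exact Q.isCell C hC)
    (by
      intro x
      have h1 := P.sum_indicator x
      have h2 := Q.sum_indicator x
      simp only [Finset.sum_disjSum, Sum.elim_inl, Sum.elim_inr, id, one_mul, neg_mul,
        Finset.sum_neg_distrib]
      rw [h1, h2]
      ring)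
  simp only [Finset.sum_disjSum, Sum.elim_inl, Sum.elim_inr, one_mul, neg_mul,
    Finset.sum_neg_distrib] at h
  rw [P.eulerChar_eq_sum, Q.eulerChar_eq_sum]
  linarith

/-- The Euler characteristic may be computed from any finite cell partition. -/
theorem eulerChar_eq {n : ℕ} {S : Set (Fin n → ℝ)} (P : CellPartition S) :
    eulerChar S = P.eulerChar := by
  have h : Nonempty (CellPartition S) := ⟨P⟩
  rw [eulerChar, dif_pos h]
  exact CellPartition.eulerChar_congr _ _

/-! ### Embedded simplicial complexes and the Euler curve transform -/

/-- An embedded simplicial complex in `ℝⁿ`: the union of the simplices of a finite simplicial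
complex. -/
def IsEmbeddedSimplicialComplex {n : ℕ} (K : Set (Fin n → ℝ)) : Prop :=
  ∃ L : Geometry.SimplicialComplex ℝ (Fin n → ℝ), L.faces.Finite ∧ L.space = K

/-- The set `MK = {M⁻¹ x | x ∈ K}` (note the inverse) for `M ∈ GL_n(ℝ)`. -/
def transform {n : ℕ} (M : GL (Fin n) ℝ) (K : Set (Fin n → ℝ)) : Set (Fin n → ℝ) :=
  (fun x => (M⁻¹ : GL (Fin n) ℝ).val *ᵥ x) '' K

/-- The translate `K + w = {x + w | x ∈ K}`. -/
def translate {n : ℕ} (K : Set (Fin n → ℝ)) (w : Fin n → ℝ) : Set (Fin n → ℝ) :=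
  (fun x => x + w) '' K

/-- The unit sphere `Sⁿ⁻¹` of `ℝⁿ` for the standard dot product. -/
abbrev UnitSphere (n : ℕ) : Type :=
  {v : Fin n → ℝ // v ⬝ᵥ v = 1}

/-- The inclusion `O(n) → GL_n(ℝ)`. -/
def orthogonalToGL {n : ℕ} (R : Matrix.orthogonalGroup (Fin n) ℝ) : GL (Fin n) ℝ :=
  Unitary.toUnits R

theorem orthogonal_dotProduct_self {n : ℕ} (R : Matrix.orthogonalGroup (Fin n) ℝ)
    (v : Fin n → ℝ) : (R.val *ᵥ v) ⬝ᵥ (R.val *ᵥ v) = v ⬝ᵥ v := by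
  have h : R.valᵀ * R.val = 1 := (Matrix.mem_orthogonalGroup_iff' (Fin n) ℝ).1 R.2
  rw [Matrix.dotProduct_mulVec, ← Matrix.mulVec_transpose, Matrix.mulVec_mulVec, h,
    Matrix.one_mulVec]

/-- The action `v ↦ Rv` of `O(n)` on the unit sphere. -/
def rotate {n : ℕ} (R : Matrix.orthogonalGroup (Fin n) ℝ) (v : UnitSphere n) : UnitSphere n :=
  ⟨R.val *ᵥ v.val, (orthogonal_dotProduct_self R v.val).trans v.2⟩

/-- The sublevel set `K_{v,r} = {x | x · v ≤ r} ∩ K`. -/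
def sublevel {n : ℕ} (K : Set (Fin n → ℝ)) (v : UnitSphere n) (r : ℝ) : Set (Fin n → ℝ) :=
  {x | x ⬝ᵥ v.val ≤ r} ∩ K

/-- The Euler curve transform `F_K : Sⁿ⁻¹ × ℝ → ℝ`, `F_K(v, r) = χ(K_{v,r})`. -/
noncomputable def eulerCurveTransform {n : ℕ} (K : Set (Fin n → ℝ)) :
    UnitSphere n × ℝ → ℝ :=
  fun p => (eulerChar (sublevel K p.1 p.2) : ℝ)

end EulerCurve

namespace EulerCurve

/-! ### The Euler characteristic and compact convex sets -/

/-! The rigid motion `x ↦ R⁻¹x + w` carries the sublevel set of `K` for `(Rv, r - v·w)` onto that of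
`RK + w` for `(v, r)`, because `(R⁻¹x + w)·v = x·Rv + v·w`. What needs proof is that the motion
preserves `χ`. This is not formal: cells are built along the coordinate axes, and a rotation need
not send cells to cells.

The remedy is to compute `χ` without reference to coordinates. A sublevel set of `K` is a finite
union of compact convex sets, namely simplices cut by a half-space. By inclusion-exclusion, and
because a nonempty compact convex set counts as `1`, its `χ` depends only on which subfamilies have
a common point (`eulerChar_biUnion_convex`). Injective affine maps preserve this nerve together with
convexity and compactness. The value `1` comes from `cell_relation_convex`, by induction on the
dimension: along the projection forgetting the last coordinate, nonempty fibres of compact convex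
sets are compact intervals, and the images are again compact convex. Since it concerns arbitrary
linear relations between indicator functions, the separate convex sets need no cell partitions.

Existence of partitions is a linear form of cylindrical decomposition: sublevel sets are described
by signs of finitely many affine functionals, and `exists_isCell_signClass` enlarges the family
until every sign class is a cell. -/

theorem ind_Icc {a b : ℝ} (hab : a ≤ b) (t : ℝ) :
    ind (Set.Icc a b) t = ind Set.univ t - ind (Set.Iio a) t - ind (Set.Ioi b) t := by
  rcases lt_or_ge t a with h | h
  · simp [ind, h, not_lt.2 (h.le.trans hab)]
  · rcases lt_or_ge b t with h' | h'
    · simp [ind, h', not_lt.2 h]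
    · simp [ind, h, h', not_lt.2]

/-- A linear relation between the indicator functions of points, open intervals and compact
intervals of the line is respected by the Euler characteristic. -/
theorem fibre_relation_Icc {ι κ : Type*} (I : Finset ι) (J : Finset κ) (c e : ι → ℤ)
    (A : ι → Set ℝ) (b : κ → ℤ) (D : κ → Set ℝ) (hA : ∀ i ∈ I, FibreType (A i) (e i))
    (hD : ∀ j ∈ J, ∃ p q : ℝ, p ≤ q ∧ D j = Set.Icc p q)
    (h : ∀ t, ∑ i ∈ I, c i * ind (A i) t = ∑ j ∈ J, b j * ind (D j) t) :
    ∑ i ∈ I, c i * e i = ∑ j ∈ J, b j := by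
  choose! p q hpq hD using hD
  -- Each compact interval is replaced by the line minus two open rays, all three of value `-1`, so
  -- it counts `-1 + 1 + 1 = 1`. The coefficients `-b, b, b` arise from moving these terms to the
  -- left-hand side.
  have key := fibre_relation (I.disjSum (J.disjSum (J.disjSum J)))
    (Sum.elim c (Sum.elim (fun j => -b j) (Sum.elim b b)))
    (Sum.elim e fun _ => -1)
    (Sum.elim A (Sum.elim (fun _ => Set.univ)
      (Sum.elim (fun j => Set.Iio (p j)) fun j => Set.Ioi (q j)))) ?_ ?_
  · simp only [Finset.sum_disjSum, Sum.elim_inl, Sum.elim_inr, ← Finset.sum_mul,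
      Finset.sum_neg_distrib] at key
    linarith
  · intro i hi
    rcases Finset.mem_disjSum.1 hi with ⟨i, hi₁, rfl⟩ | ⟨i, hi₁, rfl⟩
    · exact hA i hi₁
    · refine Or.inr ?_
      rcases Finset.mem_disjSum.1 hi₁ with ⟨j, hj, rfl⟩ | ⟨i, hi₂, rfl⟩
      · exact ⟨⊥, ⊤, bot_lt_top, by ext; simp, rfl⟩
      · rcases Finset.mem_disjSum.1 hi₂ with ⟨j, hj, rfl⟩ | ⟨j, hj, rfl⟩
        · exact ⟨⊥, p j, EReal.bot_lt_coe _, by ext; simp, rfl⟩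
        · exact ⟨q j, ⊤, EReal.coe_lt_top _, by ext; simp, rfl⟩
  · intro t
    simp only [Finset.sum_disjSum, Sum.elim_inl, Sum.elim_inr]
    rw [h t, Finset.sum_congr rfl fun j hj => by rw [hD j hj, ind_Icc (hpq j hj)]]
    simp only [mul_sub, neg_mul, Finset.sum_sub_distrib, Finset.sum_neg_distrib]
    ring

/-- The fibre is the projection to the last coordinate of a slice of `D` by a closed affine
subspace, hence convex, compact and nonempty in `ℝ`. -/
theorem exists_fibre_eq_Icc {n : ℕ} {D : Set (Fin (n + 1) → ℝ)} (hc : Convex ℝ D)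
    (hk : IsCompact D) {y : Fin n → ℝ} (hy : y ∈ (Fin.init '' D : Set (Fin n → ℝ))) :
    ∃ p q : ℝ, p ≤ q ∧ {t : ℝ | Fin.snoc (α := fun _ => ℝ) y t ∈ D} = Set.Icc p q := by
  have himg : {t : ℝ | Fin.snoc (α := fun _ => ℝ) y t ∈ D}
      = (fun x : Fin (n + 1) → ℝ => x (Fin.last n)) '' (D ∩ {x | Fin.init x = y}) := by
    ext t
    constructor
    · intro ht
      exact ⟨_, ⟨ht, by simp⟩, by simp⟩
    · rintro ⟨x, ⟨hx, rfl⟩, rfl⟩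
      simpa using hx
  have hinit : IsLinearMap ℝ (Fin.init : (Fin (n + 1) → ℝ) → (Fin n → ℝ)) :=
    ⟨fun _ _ => rfl, fun _ _ => rfl⟩
  have hcont : Continuous (Fin.init : (Fin (n + 1) → ℝ) → (Fin n → ℝ)) :=
    continuous_pi fun i => continuous_apply _
  have h1 : Convex ℝ {t : ℝ | Fin.snoc (α := fun _ => ℝ) y t ∈ D} := by
    rw [himg]
    exact (hc.inter ((convex_singleton y).is_linear_preimage hinit)).is_linear_image
      ⟨fun _ _ => rfl, fun _ _ => rfl⟩
  have h2 : IsCompact {t : ℝ | Fin.snoc (α := fun _ => ℝ) y t ∈ D} := by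
    rw [himg]
    exact (hk.inter_right (isClosed_singleton.preimage hcont)).image (continuous_apply _)
  have h3 : {t : ℝ | Fin.snoc (α := fun _ => ℝ) y t ∈ D}.Nonempty := by
    obtain ⟨x, hx, rfl⟩ := hy
    exact ⟨x (Fin.last n), by simpa using hx⟩
  have h4 := eq_Icc_of_connected_compact ⟨h3, h1.isPreconnected⟩ h2
  exact ⟨_, _, Set.nonempty_Icc.1 (h4 ▸ h3), h4⟩

open Classical in
/-- A linear relation between the indicator functions of cells and of compact convex sets is
respected by the Euler characteristic, which is `1` for a nonempty compact convex set. -/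
theorem cell_relation_convex {ι κ : Type*} (I : Finset ι) (J : Finset κ) (b : κ → ℤ) :
    ∀ (n : ℕ) (c : ι → ℤ) (d : ι → ℕ) (C : ι → Set (Fin n → ℝ)) (D : κ → Set (Fin n → ℝ)),
    (∀ i ∈ I, IsCell (d i) (C i)) → (∀ j ∈ J, Convex ℝ (D j)) → (∀ j ∈ J, IsCompact (D j)) →
    (∀ x, ∑ i ∈ I, c i * ind (C i) x = ∑ j ∈ J, b j * ind (D j) x) →
    ∑ i ∈ I, c i * (-1) ^ d i = ∑ j ∈ J, b j * if (D j).Nonempty then 1 else 0 := by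
  intro n
  induction n with
  | zero =>
    intro c d C D hC _ _ h
    have hl : ∀ i ∈ I, c i * (-1) ^ d i = c i * ind (C i) 0 := fun i hi => by
      obtain ⟨h1, h2⟩ : d i = 0 ∧ C i = Set.univ := by
        have hc := hC i hi
        generalize d i = a at hc
        generalize C i = E at hc
        cases hc
        exact ⟨rfl, rfl⟩
      simp [ind, h1, h2]
    rw [Finset.sum_congr rfl hl, h 0]
    refine Finset.sum_congr rfl fun j _ => ?_
    have : (D j).Nonempty ↔ (0 : Fin 0 → ℝ) ∈ D j :=
      ⟨fun ⟨x, hx⟩ => Subsingleton.elim x 0 ▸ hx, fun hx => ⟨0, hx⟩⟩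
    simp only [ind, this]
  | succ n ih =>
    intro c d C D hC hD hD' h
    have hf := fun i hi => (hC i hi).fibres
    choose! B k e A hB hd hA hm using hf
    -- Integration over the fibres of the projection: a cell becomes its base, weighted by the Euler
    -- characteristic `e` of its fibre; a convex set becomes its shadow with unchanged weight, since
    -- its nonempty fibres have Euler characteristic `1`.
    have h2 := ih (fun i => c i * e i) k B (fun j => Fin.init '' D j) hB
      (fun j hj => (hD j hj).is_linear_image ⟨fun _ _ => rfl, fun _ _ => rfl⟩)
      (fun j hj => (hD' j hj).image (continuous_pi fun i => continuous_apply _)) (fun y => ?_)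
    · simp only [Set.image_nonempty] at h2
      rw [← h2]
      exact Finset.sum_congr rfl fun i hi => by rw [hd i hi]; ring
    -- Only the sets with nonempty fibre over `y` take part, as the empty set is neither a point nor
    -- an interval of the admitted kinds.
    · have h3 := fibre_relation_Icc (I.filter fun i => y ∈ B i)
        (J.filter fun j => y ∈ (Fin.init '' D j : Set (Fin n → ℝ))) c e (fun i => A i y) b
        (fun j => {t | Fin.snoc (α := fun _ => ℝ) y t ∈ D j})
        (fun i hi => hA i (Finset.mem_filter.1 hi).1 y (Finset.mem_filter.1 hi).2)
        (fun j hj => exists_fibre_eq_Icc (hD j (Finset.mem_filter.1 hj).1)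
          (hD' j (Finset.mem_filter.1 hj).1) (Finset.mem_filter.1 hj).2) (fun t => by
          have h4 := h (Fin.snoc (α := fun _ => ℝ) y t)
          rw [Finset.sum_filter, Finset.sum_filter]
          refine Eq.trans ?_ (h4.trans ?_)
          · refine Finset.sum_congr rfl fun i hi => ?_
            have := hm i hi y t
            by_cases hy : y ∈ B i <;> simp [ind, this, hy]
          · refine Finset.sum_congr rfl fun j hj => ?_
            by_cases hy : y ∈ (Fin.init '' D j : Set (Fin n → ℝ))
            · rw [if_pos hy]
              rfl
            · have : Fin.snoc (α := fun _ => ℝ) y t ∉ D j := fun hx => hy ⟨_, hx, by simp⟩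
              rw [if_neg hy, ind, if_neg this, mul_zero])
      rw [Finset.sum_filter, Finset.sum_filter] at h3
      refine Eq.trans ?_ (h3.trans ?_)
      · exact Finset.sum_congr rfl fun i _ => by by_cases hy : y ∈ B i <;> simp [ind, hy]
      · refine Finset.sum_congr rfl fun j _ => ?_
        by_cases hy : y ∈ (Fin.init '' D j : Set (Fin n → ℝ))
        · rw [if_pos hy, ind, if_pos hy, mul_one]
        · rw [if_neg hy, ind, if_neg hy, mul_zero]

open Classical in
/-- The Euler characteristic of a finite union of compact convex sets depends only on the nerve
of the family. -/
theorem eulerChar_biUnion_convex {n : ℕ} {κ : Type*} (J : Finset κ) (D : κ → Set (Fin n → ℝ))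
    (hc : ∀ j ∈ J, Convex ℝ (D j)) (hk : ∀ j ∈ J, IsCompact (D j))
    (hP : Nonempty (CellPartition (⋃ j ∈ J, D j))) :
    eulerChar (⋃ j ∈ J, D j) = ∑ T ∈ J.powerset with T.Nonempty,
      (-1) ^ (T.card + 1) * if (⋂ j ∈ T, D j).Nonempty then 1 else 0 := by
  obtain ⟨P⟩ := hP
  rw [eulerChar_eq P, P.eulerChar_eq_sum]
  -- The relation equates two expansions of the indicator of the union: over the cells of `P`, and
  -- by inclusion-exclusion. `T` must be nonempty, since the empty intersection is all of `ℝⁿ`, in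
  -- general not compact.
  have h := cell_relation_convex P.cells (J.powerset.filter Finset.Nonempty)
    (fun T => (-1) ^ (T.card + 1)) n (fun _ => 1) P.dim id (fun T => ⋂ j ∈ T, D j) P.isCell
    (fun T hT => ?_) (fun T hT => ?_) (fun x => ?_)
  · simpa only [one_mul] using h
  · exact convex_iInter₂ fun j hj => hc j (Finset.mem_powerset.1 (Finset.mem_filter.1 hT).1 hj)
  · obtain ⟨hT, j, hj⟩ := Finset.mem_filter.1 hT
    have hT := Finset.mem_powerset.1 hT
    exact (hk j (hT hj)).of_isClosed_subset
      (isClosed_biInter fun i hi => (hk i (hT hi)).isClosed) (Set.biInter_subset_of_mem hj)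
  · have h1 := Finset.indicator_biUnion_eq_sum_powerset J D (fun _ => (1 : ℤ)) x
    have h2 : ∀ S : Set (Fin n → ℝ), Set.indicator S (fun _ => (1 : ℤ)) x = ind S x := fun S => by
      simp [Set.indicator, ind]
    simp only [h2, smul_eq_mul] at h1
    rw [← h1, ← P.sum_indicator x]
    simp

/-- The Euler characteristic of a finite union of compact convex sets is invariant under
injective affine maps. -/
theorem eulerChar_image_biUnion_convex {m n : ℕ} {κ : Type*} (J : Finset κ)
    (D : κ → Set (Fin m → ℝ)) (φ : (Fin m → ℝ) →ᵃ[ℝ] (Fin n → ℝ)) (hφ : Function.Injective φ)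
    (hc : ∀ j ∈ J, Convex ℝ (D j)) (hk : ∀ j ∈ J, IsCompact (D j))
    (hP : Nonempty (CellPartition (⋃ j ∈ J, D j)))
    (hQ : Nonempty (CellPartition (φ '' ⋃ j ∈ J, D j))) :
    eulerChar (φ '' ⋃ j ∈ J, D j) = eulerChar (⋃ j ∈ J, D j) := by
  classical
  rw [eulerChar_biUnion_convex J D hc hk hP]
  rw [Set.image_iUnion₂] at hQ ⊢
  rw [eulerChar_biUnion_convex J _ (fun j hj => (hc j hj).affine_image φ)
    (fun j hj => (hk j hj).image φ.continuous_of_finiteDimensional) hQ]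
  refine Finset.sum_congr rfl fun T hT => ?_
  -- Injective maps commute with nonempty intersections, so both families have the same nerve.
  rw [← hφ.injOn.image_biInter_eq (Finset.mem_filter.1 hT).2]
  simp only [Set.image_nonempty]

/-! ### Semialgebraic sets given by affine functionals -/

/-- The value at `x` of the affine functional with linear part `p.1` and constant term `p.2`. -/
def affEval {n : ℕ} (p : (Fin n → ℝ) × ℝ) (x : Fin n → ℝ) : ℝ :=
  p.1 ⬝ᵥ x + p.2

theorem continuous_affEval {n : ℕ} (p : (Fin n → ℝ) × ℝ) : Continuous (affEval p) := by
  unfold affEval dotProduct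
  fun_prop

theorem affEval_sub {n : ℕ} (p q : (Fin n → ℝ) × ℝ) (x : Fin n → ℝ) :
    affEval (p - q) x = affEval p x - affEval q x := by
  simp only [affEval, Prod.fst_sub, Prod.snd_sub, sub_dotProduct]
  ring

theorem affEval_smul {n : ℕ} (a : ℝ) (p : (Fin n → ℝ) × ℝ) (x : Fin n → ℝ) :
    affEval (a • p) x = a * affEval p x := by
  simp only [affEval, Prod.smul_fst, Prod.smul_snd, smul_dotProduct, smul_eq_mul]
  ring

/-- Every affine functional on `ℝⁿ` is of the form `affEval p`. -/
theorem exists_affEval_eq {n : ℕ} (f : (Fin n → ℝ) →ᵃ[ℝ] ℝ) : ∃ p, ∀ x, affEval p x = f x := by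
  refine ⟨(fun i => f.linear (Pi.single i 1), f 0), fun x => ?_⟩
  have h : f x = f.linear x + f 0 := by
    have := f.map_vadd 0 x
    simpa using this
  rw [h, affEval, LinearMap.pi_apply_eq_sum_univ f.linear x]
  congr 1
  refine Finset.sum_congr rfl fun i _ => ?_
  rw [smul_eq_mul, mul_comm]
  refine congrArg (x i * ·) (congrArg f.linear (funext fun j => ?_))
  simp [Pi.single_apply, eq_comm]

/-- The restriction of an affine functional on `ℝⁿ⁺¹` to the hyperplane `ℝⁿ`. -/
def affRestrict {n : ℕ} (p : (Fin (n + 1) → ℝ) × ℝ) : (Fin n → ℝ) × ℝ :=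
  (Fin.init p.1, p.2)

/-- The pullback of an affine functional on `ℝⁿ` under the projection `ℝⁿ⁺¹ → ℝⁿ`. -/
def affLift {n : ℕ} (p : (Fin n → ℝ) × ℝ) : (Fin (n + 1) → ℝ) × ℝ :=
  (Fin.snoc (α := fun _ => ℝ) p.1 0, p.2)

theorem affEval_succ {n : ℕ} (p : (Fin (n + 1) → ℝ) × ℝ) (x : Fin (n + 1) → ℝ) :
    affEval p x = affEval (affRestrict p) (Fin.init x) + p.1 (Fin.last n) * x (Fin.last n) := by
  simp only [affEval, affRestrict, dotProduct, Fin.sum_univ_castSucc, Fin.init]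
  ring

theorem affEval_lift {n : ℕ} (p : (Fin n → ℝ) × ℝ) (x : Fin (n + 1) → ℝ) :
    affEval (affLift p) x = affEval p (Fin.init x) := by
  simp [affEval_succ, affRestrict, affLift]

theorem exists_eval_eq_affEval {n : ℕ} (p : (Fin n → ℝ) × ℝ) :
    ∃ f : MvPolynomial (Fin n) ℝ, ∀ x, MvPolynomial.eval x f = affEval p x :=
  ⟨∑ i, MvPolynomial.C (p.1 i) * MvPolynomial.X i + MvPolynomial.C p.2, fun x => by
    simp [affEval, dotProduct]⟩

theorem isSemialgebraic_affEval_eq_zero {n : ℕ} (p : (Fin n → ℝ) × ℝ) :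
    IsSemialgebraic {x | affEval p x = 0} := by
  obtain ⟨f, hf⟩ := exists_eval_eq_affEval p
  simpa only [hf] using IsSemialgebraic.zero f

theorem isSemialgebraic_sign_affEval {n : ℕ} (p : (Fin n → ℝ) × ℝ) (σ : SignType) :
    IsSemialgebraic {x | SignType.sign (affEval p x) = σ} := by
  obtain ⟨f, hf⟩ := exists_eval_eq_affEval p
  cases σ with
  | zero => simpa [sign_eq_zero_iff] using isSemialgebraic_affEval_eq_zero p
  | pos => simpa [sign_eq_one_iff, hf] using IsSemialgebraic.pos f
  | neg => simpa [sign_eq_neg_one_iff, hf] using IsSemialgebraic.pos (-f)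

theorem isSemialgebraic_univ {n : ℕ} : IsSemialgebraic (Set.univ : Set (Fin n → ℝ)) := by
  simpa using IsSemialgebraic.zero (0 : MvPolynomial (Fin n) ℝ)

theorem IsSemialgebraic.preimage_init {n : ℕ} {A : Set (Fin n → ℝ)} (hA : IsSemialgebraic A) :
    IsSemialgebraic {x : Fin (n + 1) → ℝ | Fin.init x ∈ A} := by
  have h : ∀ (f : MvPolynomial (Fin n) ℝ) (x : Fin (n + 1) → ℝ),
      MvPolynomial.eval (Fin.init x) f
        = MvPolynomial.eval x (MvPolynomial.rename Fin.castSucc f) := fun f x => by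
    rw [MvPolynomial.eval_rename]
    rfl
  induction hA with
  | pos f => simpa only [Set.mem_ofPred_eq, h] using IsSemialgebraic.pos _
  | zero f => simpa only [Set.mem_ofPred_eq, h] using IsSemialgebraic.zero _
  | union _ _ ihA ihB => exact ihA.union ihB
  | inter _ _ ihA ihB => exact ihA.inter ihB

theorem isCellFunction_affEval {n : ℕ} {B : Set (Fin n → ℝ)} (hB : IsSemialgebraic B)
    (p : (Fin n → ℝ) × ℝ) : IsCellFunction B (affEval p) := by
  refine ⟨(continuous_affEval p).continuousOn, hB.preimage_init.inter ?_⟩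
  change IsSemialgebraic {x : Fin (n + 1) → ℝ | x (Fin.last n) = affEval p (Fin.init x)}
  have h : {x : Fin (n + 1) → ℝ | x (Fin.last n) = affEval p (Fin.init x)}
      = {x | affEval (Fin.snoc (α := fun _ => ℝ) p.1 (-1), p.2) x = 0} := by
    ext x
    simp only [affEval_succ, affRestrict, Set.mem_ofPred_eq, Fin.init_snoc, Fin.snoc_last]
    constructor <;> intro h <;> linarith
  rw [h]
  exact isSemialgebraic_affEval_eq_zero _

/-! ### Sign classes are cells -/

/-- The points at which all functionals in `F` have the same sign as at `x`. -/
def signClass {n : ℕ} (F : Finset ((Fin n → ℝ) × ℝ)) (x : Fin n → ℝ) : Set (Fin n → ℝ) :=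
  {y | ∀ p ∈ F, SignType.sign (affEval p y) = SignType.sign (affEval p x)}

theorem mem_signClass_self {n : ℕ} (F : Finset ((Fin n → ℝ) × ℝ)) (x : Fin n → ℝ) :
    x ∈ signClass F x := fun _ _ => rfl

theorem signClass_anti {n : ℕ} {F G : Finset ((Fin n → ℝ) × ℝ)} (h : F ⊆ G) (x : Fin n → ℝ) :
    signClass G x ⊆ signClass F x := fun _ hy p hp => hy p (h hp)

theorem signClass_eq_of_mem {n : ℕ} {F : Finset ((Fin n → ℝ) × ℝ)} {x y : Fin n → ℝ}
    (h : y ∈ signClass F x) : signClass F y = signClass F x := by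
  ext z
  exact forall₂_congr fun p hp => by rw [h p hp]

theorem isSemialgebraic_signClass {n : ℕ} (F : Finset ((Fin n → ℝ) × ℝ)) (x : Fin n → ℝ) :
    IsSemialgebraic (signClass F x) := by
  classical
  induction F using Finset.induction_on with
  | empty => simpa [signClass] using isSemialgebraic_univ
  | insert p F _ ih =>
    have h : signClass (insert p F) x
        = {y | SignType.sign (affEval p y) = SignType.sign (affEval p x)} ∩ signClass F x := by
      ext y
      simp [signClass]
    exact h ▸ (isSemialgebraic_sign_affEval _ _).inter ih

/-- If a finite set of affine functionals is ordered in the same way at all points of `B`, then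
their maximum (`-∞` if there are none) bounds cells over `B`. -/
theorem exists_lower_cellBound {n : ℕ} {B : Set (Fin n → ℝ)} (hB : IsSemialgebraic B)
    (L : Finset ((Fin n → ℝ) × ℝ)) (y₀ : Fin n → ℝ)
    (hL : ∀ p ∈ L, ∀ q ∈ L, affEval p y₀ ≤ affEval q y₀ →
      ∀ y ∈ B, affEval p y ≤ affEval q y) :
    ∃ f, IsCellBound B f ∧
      ∀ y ∈ B, ∀ t : ℝ, f y < (t : EReal) ↔ ∀ p ∈ L, affEval p y < t := by
  rcases L.eq_empty_or_nonempty with rfl | hne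
  · exact ⟨fun _ => ⊥, Or.inl fun _ _ => rfl, by simp⟩
  · obtain ⟨q, hq, hmax⟩ := L.exists_max_image (fun p => affEval p y₀) hne
    refine ⟨fun y => (affEval q y : ℝ),
      Or.inr (Or.inr ⟨_, isCellFunction_affEval hB q, fun _ _ => rfl⟩), fun y hy t => ?_⟩
    rw [EReal.coe_lt_coe_iff]
    exact ⟨fun h p hp => (hL p hp q hq (hmax p hp) y hy).trans_lt h, fun h => h q hq⟩

/-- If a finite set of affine functionals is ordered in the same way at all points of `B`, then
their minimum (`+∞` if there are none) bounds cells over `B`. -/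
theorem exists_upper_cellBound {n : ℕ} {B : Set (Fin n → ℝ)} (hB : IsSemialgebraic B)
    (U : Finset ((Fin n → ℝ) × ℝ)) (y₀ : Fin n → ℝ)
    (hU : ∀ p ∈ U, ∀ q ∈ U, affEval p y₀ ≤ affEval q y₀ →
      ∀ y ∈ B, affEval p y ≤ affEval q y) :
    ∃ g, IsCellBound B g ∧
      ∀ y ∈ B, ∀ t : ℝ, (t : EReal) < g y ↔ ∀ p ∈ U, t < affEval p y := by
  rcases U.eq_empty_or_nonempty with rfl | hne
  · exact ⟨fun _ => ⊤, Or.inr (Or.inl fun _ _ => rfl), by simp⟩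
  · obtain ⟨q, hq, hmin⟩ := U.exists_min_image (fun p => affEval p y₀) hne
    refine ⟨fun y => (affEval q y : ℝ),
      Or.inr (Or.inr ⟨_, isCellFunction_affEval hB q, fun _ _ => rfl⟩), fun y hy t => ?_⟩
    rw [EReal.coe_lt_coe_iff]
    exact ⟨fun h p hp => h.trans_le (hU q hq p hp (hmin p hp) y hy), fun h => h q hq⟩

/-- Over a cell on which the differences of finitely many affine functionals have constant signs,
prescribing the position of the last coordinate relative to these functionals defines a cell. -/
theorem exists_isCell_of_sign_sub {n d : ℕ} {B : Set (Fin n → ℝ)} (hB : IsCell d B)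
    (hB' : IsSemialgebraic B) (H : Finset ((Fin n → ℝ) × ℝ)) (y₀ : Fin n → ℝ)
    (hH : ∀ p ∈ H, ∀ q ∈ H, ∀ y ∈ B, SignType.sign (affEval p y - affEval q y)
      = SignType.sign (affEval p y₀ - affEval q y₀)) (t₀ : ℝ) :
    ∃ e, IsCell e {x : Fin (n + 1) → ℝ | Fin.init x ∈ B ∧
      ∀ p ∈ H, SignType.sign (x (Fin.last n) - affEval p (Fin.init x))
        = SignType.sign (t₀ - affEval p y₀)} := by
  -- If `t₀` is the value at `y₀` of some functional in `H`, the set is that functional's graph.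
  -- Otherwise it is the band between the largest functional below `t₀` and the smallest one above.
  by_cases hmem : ∃ p ∈ H, t₀ = affEval p y₀
  · obtain ⟨p, hp, rfl⟩ := hmem
    have h : {x : Fin (n + 1) → ℝ | Fin.init x ∈ B ∧
        ∀ q ∈ H, SignType.sign (x (Fin.last n) - affEval q (Fin.init x))
          = SignType.sign (affEval p y₀ - affEval q y₀)} = graphOver B (affEval p) := by
      ext x
      refine and_congr_right fun hx => ⟨fun h => ?_, fun h q hq => ?_⟩
      · have := h p hp
        rw [sub_self, sign_zero, sign_eq_zero_iff] at this
        linarith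
      · rw [h, hH p hp q hq _ hx]
    exact ⟨d, h ▸ hB.graph (isCellFunction_affEval hB' p)⟩
  · push Not at hmem
    have hle : ∀ p ∈ H, ∀ q ∈ H, affEval p y₀ ≤ affEval q y₀ →
        ∀ y ∈ B, affEval p y ≤ affEval q y := fun p hp q hq h y hy => by
      by_contra hlt
      have h1 := hH p hp q hq y hy
      rw [sign_pos (by linarith), eq_comm, sign_eq_one_iff] at h1
      linarith
    have hlt : ∀ p ∈ H, ∀ q ∈ H, affEval p y₀ < affEval q y₀ →
        ∀ y ∈ B, affEval p y < affEval q y := fun p hp q hq h y hy => by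
      have h1 := hH p hp q hq y hy
      rw [sign_neg (by linarith : affEval p y₀ - affEval q y₀ < 0), sign_eq_neg_one_iff] at h1
      linarith
    obtain ⟨f, hf, hf'⟩ := exists_lower_cellBound hB' (H.filter fun p => affEval p y₀ < t₀) y₀
      fun p hp q hq => hle p (Finset.mem_filter.1 hp).1 q (Finset.mem_filter.1 hq).1
    obtain ⟨g, hg, hg'⟩ := exists_upper_cellBound hB' (H.filter fun p => t₀ < affEval p y₀) y₀
      fun p hp q hq => hle p (Finset.mem_filter.1 hp).1 q (Finset.mem_filter.1 hq).1
    have h : {x : Fin (n + 1) → ℝ | Fin.init x ∈ B ∧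
        ∀ q ∈ H, SignType.sign (x (Fin.last n) - affEval q (Fin.init x))
          = SignType.sign (t₀ - affEval q y₀)} = bandOver B f g := by
      ext x
      refine and_congr_right fun hx => ?_
      rw [hf' _ hx, hg' _ hx]
      simp only [Finset.mem_filter]
      constructor
      · refine fun h => ⟨fun p hp => ?_, fun p hp => ?_⟩
        · have h1 := h p hp.1
          rw [sign_pos (sub_pos.2 hp.2), sign_eq_one_iff] at h1
          linarith
        · have h1 := h p hp.1
          rw [sign_neg (sub_neg.2 hp.2), sign_eq_neg_one_iff] at h1
          linarith
      · rintro ⟨h1, h2⟩ p hp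
        rcases lt_or_gt_of_ne (hmem p hp) with h | h
        · rw [sign_neg (sub_neg.2 h), sign_neg (sub_neg.2 (h2 p ⟨hp, h⟩))]
        · rw [sign_pos (sub_pos.2 h), sign_pos (sub_pos.2 (h1 p ⟨hp, h⟩))]
    refine ⟨d + 1, h ▸ hB.band hf hg fun y hy => ?_⟩
    classical
    -- The band has nonempty fibres: the strict order of lower and upper functionals at `y₀`
    -- persists at `y`. Interpolating a real `t` also covers infinite bounds, where one of the
    -- finite sets is empty.
    obtain ⟨t, ht, ht'⟩ := Order.exists_between_finsets
      ((H.filter fun p => affEval p y₀ < t₀).image fun p => affEval p y)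
      ((H.filter fun p => t₀ < affEval p y₀).image fun p => affEval p y) (by
        simp only [Finset.forall_mem_image, Finset.mem_filter]
        exact fun p hp q hq => hlt p hp.1 q hq.1 (hp.2.trans hq.2) y hy)
    exact ((hf' y hy t).2 (Finset.forall_mem_image.1 ht)).trans
      ((hg' y hy t).2 (Finset.forall_mem_image.1 ht'))

/-- Every finite set of affine functionals is contained in one whose sign classes are cells. -/
theorem exists_isCell_signClass : ∀ (n : ℕ) (F : Finset ((Fin n → ℝ) × ℝ)),
    ∃ G, F ⊆ G ∧ ∀ x, ∃ d, IsCell d (signClass G x) := by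
  classical
  intro n
  induction n with
  | zero =>
    intro F
    refine ⟨F, subset_rfl, fun x => ⟨0, ?_⟩⟩
    have : signClass F x = Set.univ :=
      Set.eq_univ_of_forall fun y => Subsingleton.elim x y ▸ mem_signClass_self F x
    exact this ▸ IsCell.point
  | succ n ih =>
    intro F
    -- `root p` solves `p = 0` for the last coordinate, so the sign of `p` is that of its leading
    -- coefficient times that of the last coordinate minus `root p`.
    set root : (Fin (n + 1) → ℝ) × ℝ → (Fin n → ℝ) × ℝ :=
      fun p => (-(p.1 (Fin.last n))⁻¹) • affRestrict p with hroot
    set H := (F.filter fun p => p.1 (Fin.last n) ≠ 0).image root with hH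
    -- The family downstairs contains the functionals free of the last coordinate and all
    -- differences of roots, so the roots keep their order over each sign class. Lifting `G` back
    -- then makes each class upstairs lie over a single class of `G`.
    obtain ⟨G, hFG, hG⟩ := ih ((F.filter fun p => p.1 (Fin.last n) = 0).image affRestrict
      ∪ Finset.image₂ (fun p q => p - q) H H)
    refine ⟨F ∪ G.image affLift, Finset.subset_union_left, fun x => ?_⟩
    obtain ⟨d, hd⟩ := hG (Fin.init x)
    have hfac : ∀ p ∈ F, p.1 (Fin.last n) ≠ 0 → ∀ z : Fin (n + 1) → ℝ, affEval p z
        = p.1 (Fin.last n) * (z (Fin.last n) - affEval (root p) (Fin.init z)) := by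
      intro p _ hp z
      rw [affEval_succ, hroot, affEval_smul]
      field_simp
      ring
    have h : signClass (F ∪ G.image affLift) x = {z : Fin (n + 1) → ℝ |
        Fin.init z ∈ signClass G (Fin.init x) ∧
        ∀ p ∈ H, SignType.sign (z (Fin.last n) - affEval p (Fin.init z))
          = SignType.sign (x (Fin.last n) - affEval p (Fin.init x))} := by
      ext z
      constructor
      · refine fun hz => ⟨fun p hp => ?_, fun p hp => ?_⟩
        · have := hz (affLift p) (Finset.mem_union_right _ (Finset.mem_image_of_mem _ hp))
          simpa only [affEval_lift] using this
        · obtain ⟨q, hq, rfl⟩ := Finset.mem_image.1 hp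
          obtain ⟨hq, hq0⟩ := Finset.mem_filter.1 hq
          have := hz q (Finset.mem_union_left _ hq)
          rw [hfac q hq hq0, hfac q hq hq0, sign_mul, sign_mul] at this
          exact mul_left_cancel₀ (sign_ne_zero.2 hq0) this
      · rintro ⟨h1, h2⟩ p hp
        rcases Finset.mem_union.1 hp with hp | hp
        · by_cases hp0 : p.1 (Fin.last n) = 0
          · have := h1 (affRestrict p) (hFG (Finset.mem_union_left _
              (Finset.mem_image_of_mem _ (Finset.mem_filter.2 ⟨hp, hp0⟩))))
            simpa [affEval_succ, hp0] using this
          · rw [hfac p hp hp0, hfac p hp hp0, sign_mul, sign_mul,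
              h2 _ (Finset.mem_image_of_mem _ (Finset.mem_filter.2 ⟨hp, hp0⟩))]
        · obtain ⟨q, hq, rfl⟩ := Finset.mem_image.1 hp
          rw [affEval_lift, affEval_lift, h1 q hq]
    rw [h]
    refine exists_isCell_of_sign_sub hd (isSemialgebraic_signClass _ _) H (Fin.init x)
      (fun p hp q hq y hy => ?_) (x (Fin.last n))
    have := hy (p - q) (hFG (Finset.mem_union_right _ (Finset.mem_image₂_of_mem hp hq)))
    simpa only [affEval_sub] using this

/-! ### Semilinear sets -/

/-- Semilinear sets: membership of `x` is determined by the signs at `x` of finitely many affine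
functionals. -/
def IsSemilinear {n : ℕ} (S : Set (Fin n → ℝ)) : Prop :=
  ∃ F : Finset ((Fin n → ℝ) × ℝ), ∀ x ∈ S, signClass F x ⊆ S

/-- The cells are the sign classes of the enlarged family that meet `S`. There are finitely many
sign vectors, and classes sharing a point coincide. -/
theorem IsSemilinear.nonempty_cellPartition {n : ℕ} {S : Set (Fin n → ℝ)} (hS : IsSemilinear S) :
    Nonempty (CellPartition S) := by
  obtain ⟨F, hF⟩ := hS
  obtain ⟨G, hFG, hG⟩ := exists_isCell_signClass n F
  have hfin : (signClass G '' S).Finite := by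
    refine (Set.finite_range fun σ : G → SignType =>
      {y | ∀ p : G, SignType.sign (affEval p.1 y) = σ p}).subset ?_
    rintro _ ⟨x, -, rfl⟩
    exact ⟨fun p => SignType.sign (affEval p.1 x), by ext y; simp [signClass]⟩
  have hcell : ∀ C ∈ signClass G '' S, ∃ d, IsCell d C := by
    rintro _ ⟨x, -, rfl⟩
    exact hG x
  choose! dim hdim using hcell
  refine ⟨⟨hfin.toFinset, dim, fun C hC => hdim C (hfin.mem_toFinset.1 hC), ?_, ?_⟩⟩
  · rw [hfin.coe_toFinset]
    rintro _ ⟨x, -, rfl⟩ _ ⟨y, -, rfl⟩ hne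
    refine Set.disjoint_left.2 fun z hx hy => hne ?_
    rw [← signClass_eq_of_mem hx, ← signClass_eq_of_mem hy]
  · rw [hfin.coe_toFinset]
    refine Set.Subset.antisymm (Set.sUnion_subset ?_) fun x hx =>
      ⟨_, Set.mem_image_of_mem _ hx, mem_signClass_self G x⟩
    rintro _ ⟨x, hx, rfl⟩
    exact (signClass_anti hFG x).trans (hF x hx)

theorem IsSemilinear.inter {n : ℕ} {S T : Set (Fin n → ℝ)} (hS : IsSemilinear S)
    (hT : IsSemilinear T) : IsSemilinear (S ∩ T) := by
  classical
  obtain ⟨F, hF⟩ := hS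
  obtain ⟨G, hG⟩ := hT
  exact ⟨F ∪ G, fun x hx => Set.subset_inter
    ((signClass_anti Finset.subset_union_left x).trans (hF x hx.1))
    ((signClass_anti Finset.subset_union_right x).trans (hG x hx.2))⟩

theorem isSemilinear_biUnion {n : ℕ} {κ : Type*} (J : Finset κ) (S : κ → Set (Fin n → ℝ))
    (h : ∀ j ∈ J, IsSemilinear (S j)) : IsSemilinear (⋃ j ∈ J, S j) := by
  classical
  choose! F hF using h
  refine ⟨J.biUnion F, fun x hx => ?_⟩
  obtain ⟨j, hj, hx⟩ := Set.mem_iUnion₂.1 hx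
  exact ((signClass_anti (Finset.subset_biUnion_of_mem F hj) x).trans (hF j hj x hx)).trans
    (Set.subset_biUnion_of_mem (u := S) hj)

theorem isSemilinear_dotProduct_le {n : ℕ} (v : Fin n → ℝ) (r : ℝ) :
    IsSemilinear {x | x ⬝ᵥ v ≤ r} := by
  refine ⟨{(v, -r)}, fun x hx y hy => ?_⟩
  have h1 := hy (v, -r) (Finset.mem_singleton_self _)
  simp only [affEval, dotProduct_comm v] at h1
  simp only [Set.mem_ofPred_eq] at hx ⊢
  by_contra hlt
  rw [sign_pos (by linarith), eq_comm, sign_eq_one_iff] at h1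
  linarith

/-! ### Simplicial complexes -/

/-- The conditions on the right are convex and hold at the vertices in `s`. Conversely, barycentric
coordinates write `x` as a convex combination in which vertices outside `s` have weight zero. Thus
faces of every dimension are given by sign conditions. -/
theorem _root_.AffineBasis.convexHull_image_eq_coord {ι R E : Type*} [Fintype ι] [Field R]
    [LinearOrder R] [IsStrictOrderedRing R] [AddCommGroup E] [Module R E]
    (b : AffineBasis ι R E) (s : Set ι) :
    convexHull R (b '' s) = {x | ∀ i, 0 ≤ b.coord i x ∧ (i ∉ s → b.coord i x = 0)} := by
  classical
  refine Set.Subset.antisymm (fun x hx i => ⟨?_, fun hi => ?_⟩) fun x hx => ?_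
  · have := convexHull_mono (Set.image_subset_range b s) hx
    rw [b.convexHull_eq_nonneg_coord] at this
    exact this i
  · have hconv : Convex R (b.coord i ⁻¹' {0}) := (convex_singleton 0).affine_preimage _
    refine convexHull_min ?_ hconv hx
    rintro _ ⟨j, hj, rfl⟩
    exact b.coord_apply_ne fun h => hi (h ▸ hj)
  · rw [← b.linear_combination_coord_eq_self x, ← Finset.sum_filter_of_ne (p := (· ∈ s))
      fun i _ hi => by_contra fun his => hi (by rw [(hx i).2 his, zero_smul])]
    refine (convex_convexHull R _).sum_mem (fun i _ => (hx i).1) ?_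
      fun i hi => subset_convexHull R _ (Set.mem_image_of_mem b (Finset.mem_filter.1 hi).2)
    rw [Finset.sum_filter_of_ne fun i _ hi => by_contra fun his => hi ((hx i).2 his),
      b.sum_coord_apply_eq_one]

/-- Extending `s` to an affine basis of `ℝⁿ` turns the barycentric coordinates into affine
functionals on the whole space, whose signs decide membership. -/
theorem isSemilinear_convexHull_of_affineIndependent {n : ℕ} {s : Set (Fin n → ℝ)}
    (hs : AffineIndependent ℝ ((↑) : s → Fin n → ℝ)) : IsSemilinear (convexHull ℝ s) := by
  classical
  obtain ⟨t, hst, ht, htop⟩ := exists_subset_affineIndependent_affineSpan_eq_top hs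
  let b : AffineBasis t ℝ (Fin n → ℝ) := ⟨(↑), ht, by rw [Subtype.range_coe, htop]⟩
  have : Fintype t := @Fintype.ofFinite t b.finite
  have himg : s = b '' ((↑) ⁻¹' s) := by
    change s = Subtype.val '' (Subtype.val ⁻¹' s)
    rw [Subtype.image_preimage_coe, Set.inter_eq_right.2 hst]
  rw [himg, b.convexHull_image_eq_coord]
  choose p hp using fun i => exists_affEval_eq (b.coord i)
  refine ⟨Finset.univ.image p, fun x hx y hy i => ?_⟩
  have h := hy (p i) (Finset.mem_image_of_mem p (Finset.mem_univ i))
  rw [hp, hp] at h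
  refine ⟨?_, fun hi => ?_⟩
  · rw [← sign_nonneg_iff, h, sign_nonneg_iff]
    exact (hx i).1
  · rwa [(hx i).2 hi, sign_zero, sign_eq_zero_iff] at h

theorem IsEmbeddedSimplicialComplex.nonempty_cellPartition_sublevel {n : ℕ}
    {K : Set (Fin n → ℝ)} (hK : IsEmbeddedSimplicialComplex K) (v : UnitSphere n) (r : ℝ) :
    Nonempty (CellPartition (sublevel K v r)) := by
  obtain ⟨L, hL, rfl⟩ := hK
  refine ((isSemilinear_dotProduct_le v.val r).inter ?_).nonempty_cellPartition
  have h := isSemilinear_biUnion hL.toFinset (fun s => convexHull ℝ (s : Set (Fin n → ℝ)))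
    fun s hs => isSemilinear_convexHull_of_affineIndependent (L.indep (hL.mem_toFinset.1 hs))
  simpa only [hL.mem_toFinset, Geometry.SimplicialComplex.space] using h

/-- The faces are the images of the old ones. Affine maps commute with convex hulls; injectivity
keeps vertices affinely independent and lets images commute with intersections of faces. -/
theorem IsEmbeddedSimplicialComplex.image {m n : ℕ} {K : Set (Fin m → ℝ)}
    (hK : IsEmbeddedSimplicialComplex K) (φ : (Fin m → ℝ) →ᵃ[ℝ] (Fin n → ℝ))
    (hφ : Function.Injective φ) : IsEmbeddedSimplicialComplex (φ '' K) := by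
  classical
  obtain ⟨L, hL, rfl⟩ := hK
  refine ⟨{ faces := Finset.image φ '' L.faces, isRelLowerSet_faces := ?_, indep := ?_,
            inter_subset_convexHull := ?_ }, hL.image _, ?_⟩
  · rintro _ ⟨s, hs, rfl⟩
    refine ⟨(L.nonempty_of_mem_faces hs).image φ, fun t hts ht => ?_⟩
    obtain ⟨u, hus, rfl⟩ := Finset.subset_image_iff.1 hts
    exact ⟨u, L.down_closed hs hus (Finset.image_nonempty.1 ht), rfl⟩
  · rintro _ ⟨s, hs, rfl⟩
    have h := ((L.indep hs).map' φ hφ).range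
    have hr : Set.range (φ ∘ ((↑) : s → Fin m → ℝ)) = (Finset.image φ s : Set (Fin n → ℝ)) := by
      rw [Set.range_comp, Finset.coe_image]
      congr 1
      exact Subtype.range_coe
    rw [hr] at h
    exact h
  · rintro _ _ ⟨s, hs, rfl⟩ ⟨t, ht, rfl⟩
    rw [Finset.coe_image, Finset.coe_image, ← Set.image_inter hφ, ← φ.image_convexHull,
      ← φ.image_convexHull, ← φ.image_convexHull, ← Set.image_inter hφ]
    exact Set.image_mono (L.inter_subset_convexHull hs ht)
  · simp only [Geometry.SimplicialComplex.space, Set.biUnion_image, Finset.coe_image,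
      Set.image_iUnion₂, φ.image_convexHull]

/-- The Euler characteristic of a sublevel set of an embedded simplicial complex is the
same as that of its image under an injective affine map, if that image has a cell partition. -/
theorem IsEmbeddedSimplicialComplex.eulerChar_image_sublevel {m n : ℕ} {K : Set (Fin m → ℝ)}
    (hK : IsEmbeddedSimplicialComplex K) (φ : (Fin m → ℝ) →ᵃ[ℝ] (Fin n → ℝ))
    (hφ : Function.Injective φ) (v : UnitSphere m) (r : ℝ)
    (hP : Nonempty (CellPartition (φ '' sublevel K v r))) :
    eulerChar (φ '' sublevel K v r) = eulerChar (sublevel K v r) := by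
  have hP' := hK.nonempty_cellPartition_sublevel v r
  obtain ⟨L, hL, rfl⟩ := hK
  have hcont : Continuous fun x : Fin m → ℝ => x ⬝ᵥ v.val := by
    unfold dotProduct
    fun_prop
  -- Cutting each simplex by the half-space keeps it compact and convex. The pieces need not be
  -- simplices, but only their nerve matters.
  have h : sublevel L.space v r
      = ⋃ s ∈ hL.toFinset, {x | x ⬝ᵥ v.val ≤ r} ∩ convexHull ℝ (s : Set (Fin m → ℝ)) := by
    simp only [sublevel, Geometry.SimplicialComplex.space, Set.inter_iUnion₂, hL.mem_toFinset]
  rw [h] at hP hP' ⊢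
  refine eulerChar_image_biUnion_convex _ _ φ hφ (fun s _ => ?_) (fun s _ => ?_) hP' hP
  · exact (convex_halfSpace_le ⟨fun x y => add_dotProduct x y v.val,
      fun a x => smul_dotProduct a x v.val⟩ r).inter (convex_convexHull ℝ _)
  · exact (s.finite_toSet.isCompact_convexHull ℝ).inter_left (isClosed_le hcont continuous_const)

/-! ### Rigid motions -/

/-- The affine map `x ↦ R⁻¹ x + w`. -/
noncomputable def motion {n : ℕ} (R : Matrix.orthogonalGroup (Fin n) ℝ) (w : Fin n → ℝ) :
    (Fin n → ℝ) →ᵃ[ℝ] (Fin n → ℝ) :=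
  (Matrix.mulVecLin R.valᵀ).toAffineMap + AffineMap.const ℝ _ w

theorem motion_apply {n : ℕ} (R : Matrix.orthogonalGroup (Fin n) ℝ) (w x : Fin n → ℝ) :
    motion R w x = R.valᵀ *ᵥ x + w := by
  simp [motion, Matrix.mulVec_transpose]

theorem motion_injective {n : ℕ} (R : Matrix.orthogonalGroup (Fin n) ℝ) (w : Fin n → ℝ) :
    Function.Injective (motion R w) := by
  intro x y h
  have hR : R.val * R.valᵀ = 1 := (Matrix.mem_orthogonalGroup_iff (Fin n) ℝ).1 R.2
  rw [motion_apply, motion_apply, add_left_inj] at h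
  have h1 := congrArg (R.val *ᵥ ·) h
  simpa only [Matrix.mulVec_mulVec, hR, Matrix.one_mulVec] using h1

/-- `Rᵀ` is adjoint to `R`; this is the source of both the direction `Rv` and the shift by `v·w`. -/
theorem motion_dotProduct {n : ℕ} (R : Matrix.orthogonalGroup (Fin n) ℝ) (w x v : Fin n → ℝ) :
    motion R w x ⬝ᵥ v = x ⬝ᵥ (R.val *ᵥ v) + v ⬝ᵥ w := by
  rw [motion_apply, add_dotProduct, Matrix.mulVec_transpose, Matrix.dotProduct_mulVec,
    dotProduct_comm w]

theorem translate_transform_eq_image_motion {n : ℕ} (K : Set (Fin n → ℝ))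
    (R : Matrix.orthogonalGroup (Fin n) ℝ) (w : Fin n → ℝ) :
    translate (transform (orthogonalToGL R) K) w = motion R w '' K := by
  rw [translate, transform, Set.image_image]
  refine Set.image_congr fun x _ => ?_
  rw [motion_apply]
  -- The inverse of `R` as a unit is its star, which over `ℝ` unfolds to the transpose.
  rfl

theorem sublevel_image_motion {n : ℕ} (K : Set (Fin n → ℝ))
    (R : Matrix.orthogonalGroup (Fin n) ℝ) (w : Fin n → ℝ) (v : UnitSphere n) (r : ℝ) :
    sublevel (motion R w '' K) v r
      = motion R w '' sublevel K (rotate R v) (r - v.val ⬝ᵥ w) := by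
  rw [sublevel, sublevel, Set.inter_comm, ← Set.image_inter_preimage, Set.inter_comm]
  congr 2
  ext x
  simp only [Set.mem_preimage, Set.mem_ofPred_eq, motion_dotProduct, rotate, le_sub_iff_add_le]

end EulerCurve

/-- Equivariance of the Euler curve transform of an embedded simplicial complex. The first two
parts say that both sides of the identity are well defined. -/
theorem mainTheorem3 (n : ℕ) (K : Set (Fin n → ℝ))
    (hK : EulerCurve.IsEmbeddedSimplicialComplex K)
    (R : Matrix.orthogonalGroup (Fin n) ℝ) (w : Fin n → ℝ) :
    EulerCurve.IsEmbeddedSimplicialComplex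
        (EulerCurve.translate (EulerCurve.transform (EulerCurve.orthogonalToGL R) K) w) ∧
      (∀ (v : EulerCurve.UnitSphere n) (r : ℝ),
        Nonempty (EulerCurve.CellPartition (EulerCurve.sublevel K v r)) ∧
        Nonempty (EulerCurve.CellPartition (EulerCurve.sublevel
          (EulerCurve.translate (EulerCurve.transform (EulerCurve.orthogonalToGL R) K) w) v r))) ∧
      ∀ (v : EulerCurve.UnitSphere n) (r : ℝ),
        EulerCurve.eulerCurveTransform
            (EulerCurve.translate (EulerCurve.transform (EulerCurve.orthogonalToGL R) K) w) (v, r)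
          = EulerCurve.eulerCurveTransform K (EulerCurve.rotate R v, r - v.val ⬝ᵥ w) := by
  rw [EulerCurve.translate_transform_eq_image_motion]
  have hK' := hK.image (EulerCurve.motion R w) (EulerCurve.motion_injective R w)
  refine ⟨hK', fun v r => ⟨hK.nonempty_cellPartition_sublevel v r,
    hK'.nonempty_cellPartition_sublevel v r⟩, fun v r => ?_⟩
  have hP := hK'.nonempty_cellPartition_sublevel v r
  rw [EulerCurve.sublevel_image_motion] at hP
  simp only [EulerCurve.eulerCurveTransform, EulerCurve.sublevel_image_motion]
  rw [hK.eulerChar_image_sublevel _ (EulerCurve.motion_injective R w) _ _ hP]
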